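/- Let $G=(V,E)$ be a finite DAG, let $P\ge 1$ be the number of processors and let $g\in\mathbb{N}$ be the cost of communicating one value. Every node takes one unit of work and is computed exactly once. Four scheduling models are considered. * **SPD (single-port duplex).** A schedule consists of $\pi:V\to[P]$, $t:V\to\mathbb{Z}^+$ and a set $\Gamma\subseteq V\times[P]\times[P]\times\mathbb{Z}^+$, where $(v,p_1,p_2,t_0)\in\Gamma$ means that the value of $v$ is sent from $p_1$ to $p_2$ in the time interval $(t_0,t_0+g]$. It is valid if: no two distinct nodes have the same $\pi$ and the same $t$; $(v,p_1,p_2,t_0)\in\Gamma$ implies $t(v)\le t_0$; two distinct elements of $\Gamma$ whose time intervals intersect have different senders and different receivers; for every $(u,v)\in E$, if $\pi(u)=\pi(v)$ then $t(u)<t(v)$, and if $\pi(u)\ne\pi(v)$ then there is $(u,\pi(u),\pi(v),t_0)\in\Gamma$ with $t_0+g<t(v)$. Its cost is the makespan $\max_{v\in V} t(v)$. * **$\alpha$–$\beta$ with $\alpha=0$.** As SPD, with the further condition that if $(u,p_1,p_2,t_0)\in\Gamma$, then no $v\in V$ with $\pi(v)\in\{p_1,p_2\}$ has $t_0<t(v)\le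 t_0+g$. * **BSP (with latency $L=0$).** A schedule consists of a number $S$ of supersteps (chosen freely), $\pi:V\to[P]$, $\tau:V\to[S]$ and $\Gamma\subseteq V\times[P]\times[P]\times[S]$. It is valid if: for every $(u,v)\in E$, if $\pi(u)=\pi(v)$ then $\tau(u)\le\tau(v)$, and if $\pi(u)\neq\pi(v)$ then $(u,\pi(u),\pi(v),s)\in\Gamma$ for some $s<\tau(v)$; and $(v,p_1,p_2,s)\in\Gamma$ implies $p_1=\pi(v)$ and $\tau(v)\le s$. For a superstep $s$, let $C_{work}^{(s)}$ be the maximum over $p\in[P]$ of the number of nodes $v$ with $\pi(v)=p$, $\tau(v)=s$, and let $C_{comm}^{(s)}$ be the maximum over $p\in[P]$ of the larger of the numbers of elements of $\Gamma$ with superstep $s$ that have sender $p$ and that have receiver $p$. The cost is $\sum_{s\in[S]}\big(C_{work}^{(s)}+g\cdot C_{comm}^{(s)}\big)$. * **maxBSP (with latency $L=0$).** As BSP, except that $(v,p_1,p_2,s)\in\Gamma$ requires $\tau(v)<s$, and that the cost is $\sum_{s\in[S]}\max\big(C_{work}^{(s)},\,g\cdot C_{comm}^{(s)}\big)$. Let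 $\mathrm{OPT}_{SPD}$, $\mathrm{OPT}_{\beta}$, $\mathrm{OPT}_{BSP}$, $\mathrm{OPT}_{mBSP}$ denote the minimum costs of a valid schedule of $G$ in these models, for the given $P$ and $g$. **Theorem.** 1. For every finite DAG and all parameters $P\ge 1$ and $g$, any two of the four optimum costs differ by a factor of at most $2$: $\mathrm{OPT}_A\le 2\cdot\mathrm{OPT}_B$ for all models $A,B$; in particular $\mathrm{OPT}_{BSP}\le 2\cdot\mathrm{OPT}_{SPD}$. 2. For every $\varepsilon>0$ there are a nonempty finite DAG and parameters $P,g\ge1$ for which $$\mathrm{OPT}_{\beta}\ge(2-\varepsilon)\,\mathrm{OPT}_{SPD},\quad \mathrm{OPT}_{BSP}\ge(2-\varepsilon)\,\mathrm{OPT}_{SPD},\quad \mathrm{OPT}_{\beta}\ge(2-\varepsilon)\,\mathrm{OPT}_{mBSP},\quad \mathrm{OPT}_{BSP}\ge(2-\varepsilon)\,\mathrm{OPT}_{mBSP}.$$ 3. For every $\varepsilon>0$ there are a nonempty finite DAG and parameters $P,g\ge1$ for which $$\mathrm{OPT}_{mBSP}\ge\left(\tfrac32-\varepsilon\right)\mathrm{OPT}_{SPD},\quad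 \mathrm{OPT}_{BSP}\ge\left(\tfrac32-\varepsilon\right)\mathrm{OPT}_{\beta},\quad \mathrm{OPT}_{mBSP}\ge\left(\tfrac32-\varepsilon\right)\mathrm{OPT}_{\beta}.$$ -/

import Mathlib

namespace DagSched

/-- A directed acyclic graph on the node set `V`; `Adj u v` is the edge `(u, v)`. -/
structure DAG (V : Type*) extends Digraph V where
  acyclic : ∀ v, ¬ Relation.TransGen Adj v v

/-! ### Models without barrier synchronization -/

/-- A valid schedule of `G` on `P` processors in the single-port duplex (SPD) model with
communication cost `g` (node-based communication, no duplication). Node `v` is computed on `proc v`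
at time step `time v`; `(v, p₁, p₂, t₀) ∈ comm` means that the value of `v` is sent from `p₁` to
`p₂` during the time interval `(t₀, t₀ + g]`. -/
structure SPDSchedule {V : Type*} (G : DAG V) (P g : ℕ) where
  proc : V → Fin P
  time : V → ℕ
  comm : Set (V × Fin P × Fin P × ℕ)
  time_pos : ∀ v, 0 < time v
  /-- Only values that are already computed are sent (in particular `t₀` is positive). -/
  comm_available : ∀ v p₁ p₂ t₀, (v, p₁, p₂, t₀) ∈ comm → time v ≤ t₀
  /-- Two distinct communication steps with overlapping time intervals have
  different senders and different receivers. -/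
  comm_port : ∀ v p₁ p₂ t w q₁ q₂ t', (v, p₁, p₂, t) ∈ comm → (w, q₁, q₂, t') ∈ comm →
    (v, p₁, p₂, t) ≠ (w, q₁, q₂, t') →
    ¬ Disjoint (Set.Ioc t (t + g)) (Set.Ioc t' (t' + g)) → p₁ ≠ q₁ ∧ p₂ ≠ q₂
  /-- A processor computes at most one node in each time step. -/
  compute_one : ∀ u v, proc u = proc v → time u = time v → u = v
  prec_same : ∀ u v, G.Adj u v → proc u = proc v → time u < time v
  prec_diff : ∀ u v, G.Adj u v → proc u ≠ proc v →
    ∃ t₀, (u, proc u, proc v, t₀) ∈ comm ∧ t₀ + g < time v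

/-- The makespan `max_v t(v)` (equal to `0` for the empty DAG). -/
def SPDSchedule.makespan {V : Type*} [Fintype V] {G : DAG V} {P g : ℕ}
    (σ : SPDSchedule G P g) : ℕ :=
  Finset.univ.sup σ.time

/-- The additional condition of the `α`-`β` model with `α = 0`: a processor does not compute
while it is sending or receiving a value. -/
def SPDSchedule.IsAlphaBeta {V : Type*} {G : DAG V} {P g : ℕ} (σ : SPDSchedule G P g) : Prop :=
  ∀ u p₁ p₂ t₀, (u, p₁, p₂, t₀) ∈ σ.comm →
    ∀ v, (σ.proc v = p₁ ∨ σ.proc v = p₂) → ¬ (t₀ < σ.time v ∧ σ.time v ≤ t₀ + g)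

/-! ### Models with barrier synchronization -/

/-- An assignment of the nodes to processors and to `S` supersteps, together with the set of
communication steps: `(v, p₁, p₂, s) ∈ comm` means that the value of `v` is sent from `p₁` to `p₂`
in the communication phase of superstep `s`. Each value is sent by the processor that
computed it, and a node can be computed only if each of its predecessors was computed on the same
processor in the same or an earlier superstep, or was sent to that processor in an
earlier superstep. -/
structure SuperstepSchedule {V : Type*} (G : DAG V) (P S : ℕ) where
  proc : V → Fin P
  step : V → Fin S
  comm : Finset (V × Fin P × Fin P × Fin S)
  comm_source : ∀ v p₁ p₂ s, (v, p₁, p₂, s) ∈ comm → p₁ = proc v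
  prec_same : ∀ u v, G.Adj u v → proc u = proc v → step u ≤ step v
  prec_diff : ∀ u v, G.Adj u v → proc u ≠ proc v →
    ∃ s, (u, proc u, proc v, s) ∈ comm ∧ s < step v

namespace SuperstepSchedule

variable {V : Type*} {G : DAG V} {P S : ℕ}

/-- BSP: computation precedes communication within a superstep, so the values sent in
superstep `s` are computed in superstep `s` or earlier. -/
def IsBSP (σ : SuperstepSchedule G P S) : Prop :=
  ∀ v p₁ p₂ s, (v, p₁, p₂, s) ∈ σ.comm → σ.step v ≤ s

/-- maxBSP: computation and communication of a superstep are simultaneous, so the values sent in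
superstep `s` are computed strictly before superstep `s`. -/
def IsMaxBSP (σ : SuperstepSchedule G P S) : Prop :=
  ∀ v p₁ p₂ s, (v, p₁, p₂, s) ∈ σ.comm → σ.step v < s

/-- The work cost of superstep `s`. -/
def workCost [Fintype V] (σ : SuperstepSchedule G P S) (s : Fin S) : ℕ :=
  Finset.univ.sup fun p : Fin P =>
    (Finset.univ.filter fun v : V => σ.proc v = p ∧ σ.step v = s).card

/-- The number of values sent by processor `p` in superstep `s`. -/
def sent (σ : SuperstepSchedule G P S) (s : Fin S) (p : Fin P) : ℕ :=
  (σ.comm.filter fun c => c.2.1 = p ∧ c.2.2.2 = s).card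

/-- The number of values received by processor `p` in superstep `s`. -/
def received (σ : SuperstepSchedule G P S) (s : Fin S) (p : Fin P) : ℕ :=
  (σ.comm.filter fun c => c.2.2.1 = p ∧ c.2.2.2 = s).card

/-- The communication cost (`h`-relation) of superstep `s`. -/
def commCost (σ : SuperstepSchedule G P S) (s : Fin S) : ℕ :=
  Finset.univ.sup fun p : Fin P => max (σ.sent s p) (σ.received s p)

/-- The BSP cost with communication parameter `g` and latency `L = 0`. -/
def bspCost [Fintype V] (σ : SuperstepSchedule G P S) (g : ℕ) : ℕ :=
  ∑ s : Fin S, (σ.workCost s + g * σ.commCost s)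

/-- The maxBSP cost with communication parameter `g` and latency `L = 0`. -/
def maxBSPCost [Fintype V] (σ : SuperstepSchedule G P S) (g : ℕ) : ℕ :=
  ∑ s : Fin S, max (σ.workCost s) (g * σ.commCost s)

end SuperstepSchedule

/-! ### Optimum costs

For `P ≥ 1` each of the sets below is nonempty, as all nodes can be computed on one processor. -/

/-- The four data-volume-aware models. -/
inductive Model where
  | SPD
  | maxBSP
  | alphaBeta
  | BSP

/-- `Model.Attains M G P g c`: some valid schedule of `G` in the model `M`, with `P` processors
and parameter `g`, has cost `c`. In the models with supersteps, the number `S` of supersteps is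
chosen freely. -/
def Model.Attains {V : Type*} [Fintype V] (M : Model) (G : DAG V) (P g c : ℕ) : Prop :=
  match M with
  | .SPD => ∃ σ : SPDSchedule G P g, σ.makespan = c
  | .maxBSP => ∃ (S : ℕ) (σ : SuperstepSchedule G P S), σ.IsMaxBSP ∧ σ.maxBSPCost g = c
  | .alphaBeta => ∃ σ : SPDSchedule G P g, σ.IsAlphaBeta ∧ σ.makespan = c
  | .BSP => ∃ (S : ℕ) (σ : SuperstepSchedule G P S), σ.IsBSP ∧ σ.bspCost g = c

/-- The optimum (minimum) cost of a schedule of `G` in the model `M`. -/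
noncomputable def Model.opt {V : Type*} [Fintype V] (M : Model) (G : DAG V) (P g : ℕ) : ℕ :=
  sInf {c | M.Attains G P g c}

end DagSched

/-! The factor 2 rests on a chain of inequalities: SPD is at most α–β, α–β is at most BSP, SPD is at
most maxBSP, maxBSP is at most BSP, and BSP is at most twice SPD.

A superstep becomes a block of time steps (`SuperstepSchedule.exists_spdSchedule`): by König's edge
colouring theorem, an h-relation splits into h rounds in which each processor sends and receives at
most once. The rounds run after the work for BSP, and alongside it for maxBSP. A BSP superstep
becomes two maxBSP supersteps, one for work and one for communication. Conversely
(`SPDSchedule.exists_isBSP`), a timed schedule is cut into segments of length g. A processor starts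
at most one send and one receive per segment, so work and communication each add up to at most the
makespan.

By the chain, one gap per lower bound suffices. For 2 - ε it is maxBSP against α–β, on a star:
maxBSP receives values while computing, whereas under α–β the sink's processor spends a separate
step on each of the 2n leaves. For 3/2 - ε it is α–β against maxBSP, on gadgets that must
communicate at staggered times. Without barriers every gadget finishes in about 2g. With barriers,
either a single communication superstep has about g work before it and g after it, or two of them
are needed with about g of other cost around them; both give about 3g. -/

namespace DagSched

/-! ### Ranks and topological orders -/

section Rank

variable {V K : Type*} [Fintype V] [DecidableEq K]

/-- The number of elements of the same class (with respect to `c`) that precede `v` with respect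
to `e`. -/
def classRank (c : V → K) (e : V → ℕ) (v : V) : ℕ :=
  (Finset.univ.filter fun w => c w = c v ∧ e w < e v).card

theorem classRank_lt_card (c : V → K) (e : V → ℕ) (v : V) :
    classRank c e v < (Finset.univ.filter fun w => c w = c v).card := by
  apply Finset.card_lt_card
  rw [Finset.ssubset_iff_of_subset (fun w hw => by simp at hw ⊢; exact hw.1)]
  exact ⟨v, by simp, by simp⟩

theorem classRank_lt_classRank {c : V → K} {e : V → ℕ} {u v : V} (hc : c u = c v)
    (he : e u < e v) : classRank c e u < classRank c e v := by
  apply Finset.card_lt_card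
  rw [Finset.ssubset_iff_of_subset
    (fun w hw => by simp at hw ⊢; exact ⟨hw.1.trans hc, hw.2.trans he⟩)]
  exact ⟨u, by simp [hc, he], by simp⟩

theorem classRank_injective {c : V → K} {e : V → ℕ} (hinj : Function.Injective e) {u v : V}
    (hc : c u = c v) (h : classRank c e u = classRank c e v) : u = v := by
  rcases lt_trichotomy (e u) (e v) with h' | h' | h'
  · exact absurd h (classRank_lt_classRank hc h').ne
  · exact hinj h'
  · exact absurd h (classRank_lt_classRank hc.symm h').ne'

end Rank

theorem DAG.exists_topological_order {V : Type*} [Fintype V] (G : DAG V) :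
    ∃ e : V → ℕ, Function.Injective e ∧ ∀ u v, G.Adj u v → e u < e v := by
  classical
  -- By acyclicity the number of ancestors grows strictly along edges. Scaling it by the number of
  -- nodes leaves room for an enumeration of `V` to break ties.
  let d : V → ℕ := fun v => (Finset.univ.filter fun w => Relation.TransGen G.Adj w v).card
  let i := Fintype.equivFin V
  have hd : ∀ u v, G.Adj u v → d u < d v := by
    intro u v h
    apply Finset.card_lt_card
    rw [Finset.ssubset_iff_of_subset (fun w hw => by simp at hw ⊢; exact hw.tail h)]
    exact ⟨u, by simpa using Relation.TransGen.single h, by simpa using G.acyclic u⟩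
  refine ⟨fun v => d v * Fintype.card V + i v, fun u v h => ?_, fun u v h => ?_⟩
  · have h' := congrArg (· % Fintype.card V) h
    simp only [Nat.mul_add_mod_self_right, Nat.mod_eq_of_lt (i _).isLt] at h'
    exact i.injective (Fin.ext h')
  · have h1 := (i u).isLt
    have h2 := Nat.mul_le_mul_right (Fintype.card V) (Nat.succ_le_of_lt (hd u v h))
    rw [Nat.succ_mul] at h2
    show d u * Fintype.card V + i u < d v * Fintype.card V + i v
    omega

/-! ### König's edge colouring theorem for bipartite multigraphs -/

/-- Induction on the degree: a regular bipartite multigraph has a perfect matching by Hall's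
theorem, and this matching becomes the last colour class. -/
theorem exists_edge_coloring_of_regular {ι α : Type*} [Fintype ι] [DecidableEq ι]
    (src dst : α → ι) (Δ : ℕ) : ∀ E : Finset α,
    (∀ p, (E.filter fun e => src e = p).card = Δ) → (∀ p, (E.filter fun e => dst e = p).card = Δ) →
    ∃ col : α → ℕ, (∀ e ∈ E, col e < Δ) ∧
      ∀ e ∈ E, ∀ e' ∈ E, e ≠ e' → col e = col e' → src e ≠ src e' ∧ dst e ≠ dst e' := by
  classical
  induction Δ with
  | zero =>
    intro E hs _
    have hE : ∀ e, e ∉ E := fun e he => by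
      have := Finset.card_eq_zero.1 (hs (src e))
      exact Finset.notMem_empty e (this ▸ Finset.mem_filter.2 ⟨he, rfl⟩)
    exact ⟨fun _ => 0, fun e he => absurd he (hE e), fun e he => absurd he (hE e)⟩
  | succ Δ ih =>
    intro E hs hd
    have key : ∀ (f : α → ι), (∀ p, (E.filter fun e => f e = p).card = Δ + 1) → ∀ s : Finset ι,
        (E.filter fun e => f e ∈ s).card = s.card * (Δ + 1) := by
      intro f hf s
      rw [Finset.card_eq_sum_card_fiberwise (f := f) (t := s) (fun e he => by
        simp at he; exact he.2), Finset.sum_const_nat]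
      intro p hp
      rw [← hf p, Finset.filter_filter]
      congr 1
      ext e
      simp only [Finset.mem_filter]
      exact ⟨fun h => ⟨h.1, h.2.2⟩, fun h => ⟨h.1, h.2 ▸ hp, h.2⟩⟩
    -- Hall's condition by double counting: the `s.card * (Δ + 1)` edges leaving `s` all end in the
    -- neighbourhood of `s`, each vertex of which absorbs only `Δ + 1` edges.
    obtain ⟨m, hm, hmem⟩ := (Finset.all_card_le_biUnion_card_iff_exists_injective
      (fun p => (E.filter fun e => src e = p).image dst)).1 (by
        intro s
        refine Nat.le_of_mul_le_mul_right ?_ (Nat.succ_pos Δ)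
        rw [← Nat.succ_eq_add_one] at key
        rw [← key src hs s, ← key dst hd]
        apply Finset.card_le_card
        intro e he
        simp only [Finset.mem_filter, Finset.mem_biUnion, Finset.mem_image] at he ⊢
        exact ⟨he.1, src e, he.2, e, ⟨he.1, rfl⟩, rfl⟩)
    simp only [Finset.mem_image, Finset.mem_filter] at hmem
    choose f hf hfd using hmem
    have hfE := fun p => (hf p).1
    have hfs := fun p => (hf p).2
    have hmsurj := Finite.surjective_of_injective hm
    let M : Finset α := Finset.univ.image f
    have hM : ∀ e, e ∈ M ↔ ∃ p, f p = e := fun e => by simp [M]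
    obtain ⟨col, hlt, hcol⟩ := ih (E \ M) (by
        intro p
        have h : (E \ M).filter (fun e => src e = p) = (E.filter fun e => src e = p).erase (f p) := by
          ext e
          simp only [Finset.mem_filter, Finset.mem_sdiff, Finset.mem_erase, hM]
          constructor
          · rintro ⟨⟨h1, h2⟩, h3⟩
            exact ⟨fun h => h2 ⟨p, h.symm⟩, h1, h3⟩
          · rintro ⟨h1, h2, h3⟩
            refine ⟨⟨h2, ?_⟩, h3⟩
            rintro ⟨q, rfl⟩
            exact h1 (by rw [← h3, hfs])
        rw [h, Finset.card_erase_of_mem (by simp [hfE, hfs]), hs, Nat.add_sub_cancel]) (by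
        intro p
        obtain ⟨p', rfl⟩ := hmsurj p
        have h : (E \ M).filter (fun e => dst e = m p') =
            (E.filter fun e => dst e = m p').erase (f p') := by
          ext e
          simp only [Finset.mem_filter, Finset.mem_sdiff, Finset.mem_erase, hM]
          constructor
          · rintro ⟨⟨h1, h2⟩, h3⟩
            exact ⟨fun h => h2 ⟨p', h.symm⟩, h1, h3⟩
          · rintro ⟨h1, h2, h3⟩
            refine ⟨⟨h2, ?_⟩, h3⟩
            rintro ⟨q, rfl⟩
            exact h1 (by rw [hm ((hfd q).symm.trans h3)])
        rw [h, Finset.card_erase_of_mem (by simp [hfE, hfd]), hd, Nat.add_sub_cancel])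
    refine ⟨fun e => if e ∈ M then Δ else col e, fun e he => ?_, fun e he e' he' hne h => ?_⟩
    · dsimp only
      split_ifs with h
      · exact Nat.lt_succ_self Δ
      · exact (hlt e (Finset.mem_sdiff.2 ⟨he, h⟩)).trans (Nat.lt_succ_self Δ)
    · dsimp only at h
      split_ifs at h with h1 h2 h2
      · obtain ⟨p, rfl⟩ := (hM e).1 h1
        obtain ⟨q, rfl⟩ := (hM e').1 h2
        rw [hfs, hfs, hfd, hfd]
        have : p ≠ q := fun h => hne (by rw [h])
        exact ⟨this, fun h => this (hm h)⟩
      · exact absurd h (hlt e' (Finset.mem_sdiff.2 ⟨he', h2⟩)).ne'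
      · exact absurd h (hlt e (Finset.mem_sdiff.2 ⟨he, h1⟩)).ne
      · exact hcol e (Finset.mem_sdiff.2 ⟨he, h1⟩) e' (Finset.mem_sdiff.2 ⟨he', h2⟩) hne h

theorem exists_fiber_index {α ι : Type*} [Fintype α] [DecidableEq ι] (f : α → ι) (Δ : ℕ)
    (h : ∀ p, (Finset.univ.filter fun e => f e = p).card ≤ Δ) :
    ∃ i : α → ι × Fin Δ, Function.Injective i ∧ ∀ e, (i e).1 = f e := by
  let n : α → ℕ := fun e => Fintype.equivFin α e
  have hn : Function.Injective n := Fin.val_injective.comp (Fintype.equivFin α).injective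
  refine ⟨fun e => (f e, ⟨classRank f n e, (classRank_lt_card f n e).trans_le (h _)⟩),
    fun u v huv => ?_, fun e => rfl⟩
  simp only [Prod.mk.injEq, Fin.mk.injEq] at huv
  exact classRank_injective hn huv.1 huv.2

/-- Reduction to the regular case. Each vertex gets `Δ` slots on either side, and the edges occupy
distinct slots. The partial bijection from source slots to target slots extends to a permutation of
`ι × Fin Δ`, which is a `Δ`-regular multigraph containing the given one. -/
theorem exists_edge_coloring {ι α : Type*} [Fintype ι] [DecidableEq ι] (src dst : α → ι) (Δ : ℕ)
    (E : Finset α) (hs : ∀ p, (E.filter fun e => src e = p).card ≤ Δ)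
    (hd : ∀ p, (E.filter fun e => dst e = p).card ≤ Δ) :
    ∃ col : α → ℕ, (∀ e ∈ E, col e < Δ) ∧
      ∀ e ∈ E, ∀ e' ∈ E, e ≠ e' → col e = col e' → src e ≠ src e' ∧ dst e ≠ dst e' := by
  classical
  have hcard : ∀ (f : α → ι) (p : ι), (Finset.univ.filter fun e : E => f e = p).card =
      (E.filter fun e => f e = p).card := by
    intro f p
    rw [← Finset.card_map (Function.Embedding.subtype _)]
    congr 1
    ext e
    simp [and_comm]
  obtain ⟨i, hi, his⟩ := exists_fiber_index (fun e : E => src e) Δ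
    (fun p => (hcard src p).trans_le (hs p))
  obtain ⟨j, hj, hjd⟩ := exists_fiber_index (fun e : E => dst e) Δ
    (fun p => (hcard dst p).trans_le (hd p))
  let φ₀ : {x // x ∈ Set.range i} ≃ {x // x ∈ Set.range j} :=
    (Equiv.ofInjective i hi).symm.trans (Equiv.ofInjective j hj)
  let φ : Equiv.Perm (ι × Fin Δ) := φ₀.extendSubtype
  have hφ : ∀ e, φ (i e) = j e := by
    intro e
    rw [Equiv.extendSubtype_apply_of_mem φ₀ _ ⟨e, rfl⟩]
    have : (Equiv.ofInjective i hi).symm ⟨i e, ⟨e, rfl⟩⟩ = e :=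
      Equiv.ofInjective_symm_apply hi e
    simp [φ₀, this]
  have hfst : ∀ p : ι, (Finset.univ.filter fun x : ι × Fin Δ => x.1 = p).card = Δ := by
    intro p
    have : (Finset.univ.filter fun x : ι × Fin Δ => x.1 = p) =
        Finset.univ.image fun k : Fin Δ => (p, k) := by
      ext ⟨a, b⟩
      simp [eq_comm]
    rw [this, Finset.card_image_of_injective _ (Prod.mk_right_injective p), Finset.card_fin]
  obtain ⟨col, hlt, hcol⟩ := exists_edge_coloring_of_regular (fun x : ι × Fin Δ => x.1)
    (fun x => (φ x).1) Δ Finset.univ hfst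
    (fun p => (Finset.card_equiv φ (by simp)).trans (hfst p))
  refine ⟨fun e => if h : e ∈ E then col (i ⟨e, h⟩) else 0, fun e he => ?_,
    fun e he e' he' hne h => ?_⟩
  · simp only [he, dite_true]
    exact hlt _ (Finset.mem_univ _)
  · simp only [he, he', dite_true] at h
    have := hcol _ (Finset.mem_univ _) _ (Finset.mem_univ _)
      (fun h' => hne (congrArg Subtype.val (hi h'))) h
    simpa only [hφ, his, hjd] using this

/-! ### From supersteps to time steps -/

section Sums

variable {S : ℕ} (f : Fin S → ℕ)

theorem sum_Iio_add_le_sum_Iio {s s' : Fin S} (h : s < s') :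
    ∑ i ∈ Finset.Iio s, f i + f s ≤ ∑ i ∈ Finset.Iio s', f i := by
  rw [add_comm, ← Finset.sum_insert (by simp)]
  apply Finset.sum_le_sum_of_subset
  intro i hi
  simp only [Finset.mem_insert, Finset.mem_Iio] at hi ⊢
  rcases hi with rfl | hi
  · exact h
  · exact hi.trans h

theorem sum_Iio_add_le_sum (s : Fin S) :
    ∑ i ∈ Finset.Iio s, f i + f s ≤ ∑ i, f i := by
  rw [add_comm, ← Finset.sum_insert (by simp)]
  exact Finset.sum_le_sum_of_subset (Finset.subset_univ _)

end Sums

namespace SuperstepSchedule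

variable {V : Type*} {G : DAG V} {P S : ℕ} (σ : SuperstepSchedule G P S)

theorem card_le_workCost [Fintype V] (s : Fin S) (p : Fin P) :
    (Finset.univ.filter fun v : V => σ.proc v = p ∧ σ.step v = s).card ≤ σ.workCost s :=
  Finset.le_sup (f := fun p : Fin P =>
    (Finset.univ.filter fun v : V => σ.proc v = p ∧ σ.step v = s).card) (Finset.mem_univ p)

theorem sent_le_commCost (s : Fin S) (p : Fin P) : σ.sent s p ≤ σ.commCost s :=
  (le_max_left _ _).trans (Finset.le_sup (f := fun p : Fin P => max (σ.sent s p) (σ.received s p))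
    (Finset.mem_univ p))

theorem received_le_commCost (s : Fin S) (p : Fin P) : σ.received s p ≤ σ.commCost s :=
  (le_max_right _ _).trans (Finset.le_sup (f := fun p : Fin P => max (σ.sent s p) (σ.received s p))
    (Finset.mem_univ p))

/-- The `h`-relation of each superstep can be realized in `h` rounds, in each of which every
processor sends at most one value and receives at most one value. -/
theorem exists_rounds :
    ∃ col : V × Fin P × Fin P × Fin S → ℕ, (∀ c ∈ σ.comm, col c < σ.commCost c.2.2.2) ∧
      ∀ c ∈ σ.comm, ∀ c' ∈ σ.comm, c ≠ c' → c.2.2.2 = c'.2.2.2 → col c = col c' →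
        c.2.1 ≠ c'.2.1 ∧ c.2.2.1 ≠ c'.2.2.1 := by
  have h := fun s => exists_edge_coloring
    (fun c : V × Fin P × Fin P × Fin S => c.2.1) (fun c => c.2.2.1) (σ.commCost s)
    (σ.comm.filter fun c => c.2.2.2 = s)
    (fun p => by
      rw [Finset.filter_filter]
      simpa only [sent, and_comm] using σ.sent_le_commCost s p)
    (fun p => by
      rw [Finset.filter_filter]
      simpa only [received, and_comm] using σ.received_le_commCost s p)
  choose col hlt hcol using h
  refine ⟨fun c => col c.2.2.2 c, fun c hc => hlt _ c (by simp [hc]), ?_⟩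
  intro c hc c' hc' hne hs h
  refine hcol c.2.2.2 c (by simp [hc]) c' (by simp [hc', hs]) hne ?_
  exact h.trans (by simp only [hs])

/-- If superstep `s` is given `len s` time steps, computes during the first ones of them, and
communicates after the first `off s` of them, then the result is a schedule without barriers. -/
theorem exists_spdSchedule [Fintype V] (g : ℕ) (len off : Fin S → ℕ)
    (hW : ∀ s, σ.workCost s ≤ len s) (hC : ∀ s, off s + g * σ.commCost s ≤ len s)
    (hcomm : ∀ v p₁ p₂ s, (v, p₁, p₂, s) ∈ σ.comm →
      σ.step v < s ∨ σ.step v = s ∧ σ.workCost s ≤ off s) :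
    ∃ τ : SPDSchedule G P g, τ.makespan ≤ ∑ s, len s ∧
      ((∀ s, σ.workCost s ≤ off s) → τ.IsAlphaBeta) := by
  classical
  obtain ⟨e, he, hadj⟩ := G.exists_topological_order
  obtain ⟨col, hlt, hcol⟩ := σ.exists_rounds
  let cls : V → Fin P × Fin S := fun v => (σ.proc v, σ.step v)
  let start : Fin S → ℕ := fun s => ∑ i ∈ Finset.Iio s, len i
  have hstart : ∀ s s', s < s' → start s + len s ≤ start s' := fun s s' =>
    sum_Iio_add_le_sum_Iio len
  -- Within a block each processor computes its nodes consecutively in topological order, and the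
  -- round of colour `r` occupies the `g` steps that follow `off + g * r`.
  let time : V → ℕ := fun v => start (σ.step v) + classRank cls e v + 1
  let t₀ : V × Fin P × Fin P × Fin S → ℕ := fun c => start c.2.2.2 + off c.2.2.2 + g * col c
  have htime : ∀ v, start (σ.step v) < time v ∧
      time v ≤ start (σ.step v) + σ.workCost (σ.step v) := by
    intro v
    have h1 := classRank_lt_card cls e v
    have h2 := σ.card_le_workCost (σ.step v) (σ.proc v)
    simp only [cls, Prod.mk.injEq] at h1
    simp only [time, cls]
    omega
  have ht₀ : ∀ c ∈ σ.comm, start c.2.2.2 + off c.2.2.2 ≤ t₀ c ∧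
      t₀ c + g ≤ start c.2.2.2 + len c.2.2.2 := by
    intro c hc
    have h1 := Nat.mul_le_mul_left g (Nat.succ_le_of_lt (hlt c hc))
    have h2 := hC c.2.2.2
    rw [Nat.mul_succ] at h1
    simp only [t₀]
    omega
  have hlen : ∀ v, time v ≤ start (σ.step v) + len (σ.step v) := fun v =>
    (htime v).2.trans (Nat.add_le_add_left (hW _) _)
  refine ⟨{ proc := σ.proc
            time := time
            comm := {x | ∃ c ∈ σ.comm, x = (c.1, c.2.1, c.2.2.1, t₀ c)}
            time_pos := fun v => Nat.succ_pos _
            comm_available := ?_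
            comm_port := ?_
            compute_one := ?_
            prec_same := ?_
            prec_diff := ?_ }, ?_, ?_⟩
  · rintro v p₁ p₂ t ⟨⟨v', q₁, q₂, s⟩, hc, h⟩
    simp only [Prod.mk.injEq] at h
    obtain ⟨rfl, rfl, rfl, rfl⟩ := h
    have h1 := ht₀ _ hc
    have h2 := htime v
    have h3 := hlen v
    simp only at h1 h2
    rcases hcomm _ _ _ _ hc with h | ⟨h, h'⟩
    · have := hstart _ _ h
      omega
    · rw [h] at h2
      omega
  · rintro v p₁ p₂ t w q₁ q₂ t' ⟨c, hc, h⟩ ⟨c', hc', h'⟩ hne hdis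
    simp only [Prod.mk.injEq] at h h'
    obtain ⟨rfl, rfl, rfl, rfl⟩ := h
    obtain ⟨rfl, rfl, rfl, rfl⟩ := h'
    have hcc : c ≠ c' := fun h => hne (by rw [h])
    rw [Set.not_disjoint_iff] at hdis
    obtain ⟨x, hx, hx'⟩ := hdis
    simp only [Set.mem_Ioc] at hx hx'
    have h1 := ht₀ c hc
    have h2 := ht₀ c' hc'
    have hs : c.2.2.2 = c'.2.2.2 := by
      rcases lt_trichotomy c.2.2.2 c'.2.2.2 with h | h | h
      · have := hstart _ _ h
        omega
      · exact h
      · have := hstart _ _ h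
        omega
    refine hcol c hc c' hc' hcc hs ?_
    simp only [t₀, hs] at hx hx'
    rcases lt_trichotomy (col c) (col c') with h | h | h
    · have := Nat.mul_le_mul_left g (Nat.succ_le_of_lt h)
      rw [Nat.mul_succ] at this
      omega
    · exact h
    · have := Nat.mul_le_mul_left g (Nat.succ_le_of_lt h)
      rw [Nat.mul_succ] at this
      omega
  · intro u v hp ht
    have hs : σ.step u = σ.step v := by
      have h1 := htime u
      have h2 := htime v
      have h3 := hlen u
      have h4 := hlen v
      rcases lt_trichotomy (σ.step u) (σ.step v) with h | h | h
      · have := hstart _ _ h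
        omega
      · exact h
      · have := hstart _ _ h
        omega
    have hcls : cls u = cls v := by simp only [cls, hp, hs]
    refine classRank_injective he hcls ?_
    simp only [time, hs] at ht
    omega
  · intro u v huv hp
    rcases (σ.prec_same u v huv hp).lt_or_eq with h | h
    · have h1 := hstart _ _ h
      have h2 := hlen u
      have h3 := htime v
      omega
    · have hcls : cls u = cls v := by simp only [cls, hp, h]
      have := classRank_lt_classRank hcls (hadj u v huv)
      simp only [time, h]
      omega
  · intro u v huv hp
    obtain ⟨s, hs, hlt'⟩ := σ.prec_diff u v huv hp
    refine ⟨t₀ (u, σ.proc u, σ.proc v, s), ⟨_, hs, rfl⟩, ?_⟩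
    have h1 := ht₀ _ hs
    have h2 := hstart _ _ hlt'
    have h3 := htime v
    simp only at h1
    omega
  · refine Finset.sup_le fun v _ => (hlen v).trans (sum_Iio_add_le_sum len _)
  · rintro hoff u p₁ p₂ t ⟨c, hc, h⟩ v - ⟨hv1, hv2⟩
    simp only [Prod.mk.injEq] at h
    obtain ⟨-, -, -, rfl⟩ := h
    change t₀ c < time v at hv1
    change time v ≤ t₀ c + g at hv2
    have h1 := ht₀ c hc
    have h2 := htime v
    have h3 := hlen v
    rcases lt_trichotomy (σ.step v) c.2.2.2 with h | h | h
    · have := hstart _ _ h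
      omega
    · have := hoff c.2.2.2
      rw [h] at h2
      omega
    · have := hstart _ _ h
      omega

/-- Every superstep is split into a computation and a communication superstep. -/
theorem IsBSP.exists_isMaxBSP [Fintype V] {σ : SuperstepSchedule G P S} (h : σ.IsBSP) (g : ℕ) :
    ∃ τ : SuperstepSchedule G P (S * 2), τ.IsMaxBSP ∧ τ.maxBSPCost g ≤ σ.bspCost g := by
  classical
  let φ : Fin S × Fin 2 ≃ Fin (S * 2) := finProdFinEquiv
  have hφ : ∀ s i, (φ (s, i) : ℕ) = i + 2 * s := fun s i => rfl
  let emb : V × Fin P × Fin P × Fin S → V × Fin P × Fin P × Fin (S * 2) :=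
    fun c => (c.1, c.2.1, c.2.2.1, φ (c.2.2.2, 1))
  let τ : SuperstepSchedule G P (S * 2) :=
    { proc := σ.proc
      step := fun v => φ (σ.step v, 0)
      comm := σ.comm.image emb
      comm_source := by
        intro v p₁ p₂ s hs
        obtain ⟨⟨v', q₁, q₂, s'⟩, hc, hs'⟩ := Finset.mem_image.1 hs
        simp only [emb, Prod.mk.injEq] at hs'
        obtain ⟨rfl, rfl, rfl, -⟩ := hs'
        exact σ.comm_source _ _ _ _ hc
      prec_same := by
        intro u v huv hp
        have := σ.prec_same u v huv hp
        rw [Fin.le_def] at this ⊢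
        simp only [hφ]
        omega
      prec_diff := by
        intro u v huv hp
        obtain ⟨s, hs, hlt⟩ := σ.prec_diff u v huv hp
        refine ⟨φ (s, 1), Finset.mem_image.2 ⟨_, hs, rfl⟩, ?_⟩
        rw [Fin.lt_def] at hlt ⊢
        simp only [hφ, Fin.val_zero, Fin.val_one]
        omega }
  have hinj : ∀ s s' i i', φ (s, i) = φ (s', i') → s = s' ∧ i = i' := fun s s' i i' h => by
    simpa using φ.injective h
  -- Even supersteps carry only work and odd ones only communication, so each maximum in the maxBSP
  -- cost has a single nonzero term at most.
  have hwork : ∀ s i, τ.workCost (φ (s, i)) ≤ if i = 0 then σ.workCost s else 0 := by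
    intro s i
    refine Finset.sup_le fun p _ => ?_
    split_ifs with hi
    · refine le_trans (Finset.card_le_card fun v hv => ?_) (σ.card_le_workCost s p)
      simp only [Finset.mem_filter, Finset.mem_univ, true_and] at hv ⊢
      exact ⟨hv.1, (hinj _ _ _ _ hv.2).1⟩
    · rw [Nat.le_zero, Finset.card_eq_zero, Finset.filter_eq_empty_iff]
      exact fun v _ hv => hi (hinj _ _ _ _ hv.2).2.symm
  have hcomm : ∀ s i, τ.commCost (φ (s, i)) ≤ if i = 0 then 0 else σ.commCost s := by
    intro s i
    refine Finset.sup_le fun p _ => ?_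
    split_ifs with hi
    · rw [Nat.le_zero, Nat.max_eq_zero_iff]
      constructor <;>
      · refine Finset.card_eq_zero.2 (Finset.filter_eq_empty_iff.2 fun c hc hc' => ?_)
        obtain ⟨d, -, rfl⟩ := Finset.mem_image.1 hc
        have := (hinj _ _ _ _ hc'.2).2
        rw [hi] at this
        exact absurd this (by decide)
    · refine max_le ?_ ?_
      · refine le_trans ?_ (σ.sent_le_commCost s p)
        refine le_trans (Finset.card_le_card (t := (σ.comm.filter fun c =>
          c.2.1 = p ∧ c.2.2.2 = s).image emb) fun c hc => ?_) Finset.card_image_le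
        obtain ⟨hc, hc'⟩ := Finset.mem_filter.1 hc
        obtain ⟨d, hd, rfl⟩ := Finset.mem_image.1 hc
        exact Finset.mem_image.2 ⟨d, Finset.mem_filter.2
          ⟨hd, hc'.1, (hinj _ _ _ _ hc'.2).1⟩, rfl⟩
      · refine le_trans ?_ (σ.received_le_commCost s p)
        refine le_trans (Finset.card_le_card (t := (σ.comm.filter fun c =>
          c.2.2.1 = p ∧ c.2.2.2 = s).image emb) fun c hc => ?_) Finset.card_image_le
        obtain ⟨hc, hc'⟩ := Finset.mem_filter.1 hc
        obtain ⟨d, hd, rfl⟩ := Finset.mem_image.1 hc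
        exact Finset.mem_image.2 ⟨d, Finset.mem_filter.2
          ⟨hd, hc'.1, (hinj _ _ _ _ hc'.2).1⟩, rfl⟩
  refine ⟨τ, ?_, ?_⟩
  · intro v p₁ p₂ s hs
    obtain ⟨⟨v', q₁, q₂, s'⟩, hc, hs'⟩ := Finset.mem_image.1 hs
    simp only [emb, Prod.mk.injEq] at hs'
    obtain ⟨rfl, rfl, rfl, rfl⟩ := hs'
    have := h _ _ _ _ hc
    rw [Fin.le_def] at this
    rw [Fin.lt_def]
    change (φ (σ.step v', 0) : ℕ) < _
    simp only [hφ, Fin.val_zero, Fin.val_one]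
    omega
  · unfold maxBSPCost bspCost
    rw [← Equiv.sum_comp φ, Fintype.sum_prod_type]
    refine Finset.sum_le_sum fun s _ => ?_
    rw [Fin.sum_univ_two]
    have h1 := hwork s 0
    have h2 := hwork s 1
    have h3 := Nat.mul_le_mul_left g (hcomm s 0)
    have h4 := Nat.mul_le_mul_left g (hcomm s 1)
    simp at h1 h2 h3 h4
    simp only [h2]
    refine add_le_add (max_le h1 ?_) (max_le (Nat.zero_le _) h4)
    rcases h3 with h3 | h3 <;> simp [h3]

end SuperstepSchedule

/-! ### From time steps to supersteps -/

theorem SPDSchedule.time_le_makespan {V : Type*} [Fintype V] {G : DAG V} {P g : ℕ}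
    (σ : SPDSchedule G P g) (v : V) : σ.time v ≤ σ.makespan :=
  Finset.le_sup (f := σ.time) (Finset.mem_univ v)

/-- Time is cut into segments of length `max g 1`, which become the supersteps. In each of them, a
processor starts to send (and to receive) at most one value. -/
theorem SPDSchedule.exists_isBSP {V : Type*} [Fintype V] {G : DAG V} {P g : ℕ}
    (σ : SPDSchedule G P g) :
    ∃ (S : ℕ) (τ : SuperstepSchedule G P S), τ.IsBSP ∧ τ.bspCost g ≤ 2 * σ.makespan := by
  classical
  -- The maximum with 1 keeps the segments nonempty when `g = 0`. Time steps start at 1, hence the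
  -- shift in `(t - 1) / l`.
  obtain ⟨l, hl⟩ : ∃ l, l = max g 1 := ⟨_, rfl⟩
  have hl0 : 0 < l := by omega
  obtain ⟨T, hT⟩ : ∃ T, T = σ.makespan := ⟨_, rfl⟩
  have hle : ∀ v, σ.time v ≤ T := fun v => hT ▸ σ.time_le_makespan v
  let N := (T - 1) / l
  let step : V → Fin (N + 1) := fun v => ⟨(σ.time v - 1) / l, Nat.lt_succ_of_le
    (Nat.div_le_div_right (Nat.sub_le_sub_right (hle v) 1))⟩
  let τ : SuperstepSchedule G P (N + 1) :=
    { proc := σ.proc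
      step := step
      -- Transmissions by a processor other than the one that computed the value are dropped, as BSP
      -- forbids them. Those starting in the last segment are dropped too: they arrive too late to
      -- be used, and without them communication is charged to `N` full segments only, which fit
      -- into the makespan.
      comm := Finset.univ.filter fun c => c.2.1 = σ.proc c.1 ∧ (c.2.2.2 : ℕ) < N ∧
        ∃ t₀, (c.1, c.2.1, c.2.2.1, t₀) ∈ σ.comm ∧ (t₀ - 1) / l = c.2.2.2
      comm_source := fun v p₁ p₂ s h => (Finset.mem_filter.1 h).2.1
      prec_same := fun u v huv hp => by
        rw [Fin.le_def]
        exact Nat.div_le_div_right (Nat.sub_le_sub_right (σ.prec_same u v huv hp).le 1)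
      prec_diff := fun u v huv hp => by
        obtain ⟨t₀, h, hlt⟩ := σ.prec_diff u v huv hp
        have h1 := σ.comm_available _ _ _ _ h
        have h2 := σ.time_pos u
        -- From `t₀ + g < time v` follows `t₀ + l ≤ time v`, also for `g = 0`; so `v` lies in a
        -- strictly later segment than the start of the transmission.
        have h3 : (t₀ - 1) / l + 1 ≤ (σ.time v - 1) / l := by
          rw [← Nat.add_div_right _ hl0]
          exact Nat.div_le_div_right (by omega)
        have h4 := (step v).isLt
        simp only [step] at h4
        refine ⟨⟨(t₀ - 1) / l, by omega⟩, Finset.mem_filter.2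
          ⟨Finset.mem_univ _, rfl, ?_, t₀, h, rfl⟩, ?_⟩
        · simp only
          omega
        · rw [Fin.lt_def]
          exact h3 }
  have hwork : ∀ s : Fin (N + 1), τ.workCost s ≤
      ((Finset.Icc 1 T).filter fun t => (t - 1) / l = s).card := by
    intro s
    refine Finset.sup_le fun p _ => Finset.card_le_card_of_injOn σ.time ?_ ?_
    · intro v hv
      obtain ⟨-, -, hv⟩ := Finset.mem_filter.1 hv
      simp only [Finset.coe_filter, Finset.mem_Icc, Set.mem_ofPred_eq]
      exact ⟨⟨σ.time_pos v, hle v⟩, congrArg Fin.val hv⟩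
    · intro u hu v hv h
      have hu' := (Finset.mem_filter.1 hu).2.1
      have hv' := (Finset.mem_filter.1 hv).2.1
      exact σ.compute_one u v (hu'.trans hv'.symm) h
  have hworksum : ∑ s, τ.workCost s ≤ T := by
    calc ∑ s, τ.workCost s ≤ ∑ s : Fin (N + 1),
          ((Finset.Icc 1 T).filter fun t => (t - 1) / l = s).card :=
          Finset.sum_le_sum fun s _ => hwork s
      _ = ∑ s ∈ Finset.range (N + 1), ((Finset.Icc 1 T).filter fun t => (t - 1) / l = s).card :=
          Fin.sum_univ_eq_sum_range
            (fun s => ((Finset.Icc 1 T).filter fun t => (t - 1) / l = s).card) _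
      _ = (Finset.Icc 1 T).card := by
          refine (Finset.card_eq_sum_card_fiberwise fun t ht => ?_).symm
          simp only [Finset.coe_Icc, Set.mem_Icc] at ht
          simp only [Finset.coe_range, Set.mem_Iio]
          exact Nat.lt_succ_of_le (Nat.div_le_div_right (by omega))
      _ = T := by simp
  have hport : 0 < g → ∀ c ∈ τ.comm, ∀ c' ∈ τ.comm, c.2.2.2 = c'.2.2.2 →
      c.2.1 = c'.2.1 ∨ c.2.2.1 = c'.2.2.1 → c = c' := by
    rintro hg ⟨v, p₁, p₂, s⟩ hc ⟨w, q₁, q₂, s'⟩ hc' hs hp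
    obtain ⟨-, -, -, t, ht, hts⟩ := Finset.mem_filter.1 hc
    obtain ⟨-, -, -, t', ht', hts'⟩ := Finset.mem_filter.1 hc'
    simp only at hs hp ht hts ht' hts'
    subst hs
    by_contra hne
    have h1 := σ.comm_available _ _ _ _ ht
    have h2 := σ.time_pos v
    have h3 := σ.comm_available _ _ _ _ ht'
    have h4 := σ.time_pos w
    have h5 := Nat.div_add_mod (t - 1) l
    have h6 := Nat.div_add_mod (t' - 1) l
    have h7 := Nat.mod_lt (t - 1) hl0
    have h8 := Nat.mod_lt (t' - 1) hl0
    rw [hts] at h5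
    rw [hts'] at h6
    have hne' : (v, p₁, p₂, t) ≠ (w, q₁, q₂, t') := by
      intro h
      simp only [Prod.mk.injEq] at h
      obtain ⟨rfl, rfl, rfl, -⟩ := h
      exact hne rfl
    -- Two starts in one segment differ by less than `l = g`, so both intervals contain the step
    -- after the later start.
    have := σ.comm_port _ _ _ _ _ _ _ _ ht ht' hne' (by
      rw [Set.not_disjoint_iff]
      refine ⟨max t t' + 1, ?_, ?_⟩ <;> simp only [Set.mem_Ioc] <;> omega)
    tauto
  have hcomm : ∀ s : Fin (N + 1), g * τ.commCost s ≤ if (s : ℕ) < N then g else 0 := by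
    intro s
    rcases Nat.eq_zero_or_pos g with hg | hg
    · simp [hg]
    split_ifs with hs
    · refine (Nat.mul_le_mul_left g (Finset.sup_le fun p _ => max_le ?_ ?_)).trans_eq
        (Nat.mul_one g)
      · refine Finset.card_le_one.2 fun c hc c' hc' => ?_
        obtain ⟨hc, h1, h2⟩ := Finset.mem_filter.1 hc
        obtain ⟨hc', h1', h2'⟩ := Finset.mem_filter.1 hc'
        exact hport hg c hc c' hc' (h2.trans h2'.symm) (Or.inl (h1.trans h1'.symm))
      · refine Finset.card_le_one.2 fun c hc c' hc' => ?_
        obtain ⟨hc, h1, h2⟩ := Finset.mem_filter.1 hc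
        obtain ⟨hc', h1', h2'⟩ := Finset.mem_filter.1 hc'
        exact hport hg c hc c' hc' (h2.trans h2'.symm) (Or.inr (h1.trans h1'.symm))
    · have : ∀ c ∈ τ.comm, c.2.2.2 ≠ s := by
        rintro c hc rfl
        exact hs (Finset.mem_filter.1 hc).2.2.1
      have h0 : τ.commCost s ≤ 0 := Finset.sup_le fun p _ => max_le
        (Finset.card_eq_zero.2 (Finset.filter_eq_empty_iff.2 fun c hc h => this c hc h.2)).le
        (Finset.card_eq_zero.2 (Finset.filter_eq_empty_iff.2 fun c hc h => this c hc h.2)).le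
      rw [Nat.le_zero.1 h0, Nat.mul_zero]
  have hcommsum : ∑ s, g * τ.commCost s ≤ T := by
    calc ∑ s, g * τ.commCost s ≤ ∑ s : Fin (N + 1), if (s : ℕ) < N then g else 0 :=
          Finset.sum_le_sum fun s _ => hcomm s
      _ = N * g := by
          rw [Fin.sum_univ_castSucc]
          simp
      _ ≤ N * l := Nat.mul_le_mul_left _ (by omega)
      _ ≤ T := (Nat.div_mul_le_self _ _).trans (Nat.sub_le _ _)
  refine ⟨N + 1, τ, fun v p₁ p₂ s h => ?_, ?_⟩
  · obtain ⟨-, -, -, t, ht, hts⟩ := Finset.mem_filter.1 h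
    rw [Fin.le_def, ← hts]
    exact Nat.div_le_div_right (Nat.sub_le_sub_right (σ.comm_available _ _ _ _ ht) 1)
  · unfold SuperstepSchedule.bspCost
    rw [Finset.sum_add_distrib, ← hT]
    omega

/-! ### Comparison of the optimum costs -/

section Opt

variable {V : Type*} [Fintype V] (G : DAG V) {P : ℕ} (g : ℕ)

theorem Model.opt_le {M : Model} {G : DAG V} {P g c : ℕ} (h : M.Attains G P g c) :
    M.opt G P g ≤ c :=
  Nat.sInf_le h

/-- All nodes can be computed on one processor. -/
theorem Model.attains_nonempty (hP : 0 < P) (M : Model) : ∃ c, M.Attains G P g c := by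
  let σ : SuperstepSchedule G P 1 :=
    { proc := fun _ => ⟨0, hP⟩
      step := fun _ => 0
      comm := ∅
      comm_source := by simp
      prec_same := by simp
      prec_diff := fun u v _ h => absurd rfl h }
  obtain ⟨τ, -, hτ⟩ := σ.exists_spdSchedule g (fun s => σ.workCost s + g * σ.commCost s)
    (fun s => σ.workCost s) (fun s => Nat.le_add_right _ _) (fun s => le_rfl)
    (fun v p₁ p₂ s h => absurd h (Finset.notMem_empty _))
  cases M
  · exact ⟨_, τ, rfl⟩
  · exact ⟨_, 1, σ, fun v p₁ p₂ s h => absurd h (Finset.notMem_empty _), rfl⟩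
  · exact ⟨_, τ, hτ fun s => le_rfl, rfl⟩
  · exact ⟨_, 1, σ, fun v p₁ p₂ s h => absurd h (Finset.notMem_empty _), rfl⟩

theorem Model.attains_opt (hP : 0 < P) (M : Model) : M.Attains G P g (M.opt G P g) :=
  Nat.sInf_mem (M.attains_nonempty G g hP)

theorem opt_SPD_le_opt_alphaBeta (hP : 0 < P) :
    Model.SPD.opt G P g ≤ Model.alphaBeta.opt G P g := by
  obtain ⟨σ, -, h⟩ := Model.alphaBeta.attains_opt G g hP
  exact Model.opt_le ⟨σ, h⟩

theorem opt_SPD_le_opt_maxBSP (hP : 0 < P) :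
    Model.SPD.opt G P g ≤ Model.maxBSP.opt G P g := by
  obtain ⟨S, σ, hσ, h⟩ := Model.maxBSP.attains_opt G g hP
  obtain ⟨τ, hτ, -⟩ := σ.exists_spdSchedule g
    (fun s => max (σ.workCost s) (g * σ.commCost s)) (fun s => 0) (fun s => le_max_left _ _)
    (fun s => by simp) (fun v p₁ p₂ s h => Or.inl (hσ v p₁ p₂ s h))
  rw [← h]
  exact (Model.opt_le (M := .SPD) ⟨τ, rfl⟩).trans hτ

theorem opt_alphaBeta_le_opt_BSP (hP : 0 < P) :
    Model.alphaBeta.opt G P g ≤ Model.BSP.opt G P g := by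
  obtain ⟨S, σ, hσ, h⟩ := Model.BSP.attains_opt G g hP
  obtain ⟨τ, hτ, hτ'⟩ := σ.exists_spdSchedule g
    (fun s => σ.workCost s + g * σ.commCost s) (fun s => σ.workCost s)
    (fun s => Nat.le_add_right _ _) (fun s => le_rfl) (fun v p₁ p₂ s h => by
      rcases (hσ v p₁ p₂ s h).lt_or_eq with h' | h'
      · exact Or.inl h'
      · exact Or.inr ⟨h', le_rfl⟩)
  rw [← h]
  exact (Model.opt_le (M := .alphaBeta) ⟨τ, hτ' fun s => le_rfl, rfl⟩).trans hτ

theorem opt_maxBSP_le_opt_BSP (hP : 0 < P) :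
    Model.maxBSP.opt G P g ≤ Model.BSP.opt G P g := by
  obtain ⟨S, σ, hσ, h⟩ := Model.BSP.attains_opt G g hP
  obtain ⟨τ, hτ, hτ'⟩ := hσ.exists_isMaxBSP g
  rw [← h]
  exact (Model.opt_le (M := .maxBSP) ⟨_, τ, hτ, rfl⟩).trans hτ'

theorem opt_BSP_le_two_mul_opt_SPD (hP : 0 < P) :
    Model.BSP.opt G P g ≤ 2 * Model.SPD.opt G P g := by
  obtain ⟨σ, h⟩ := Model.SPD.attains_opt G g hP
  obtain ⟨S, τ, hτ, hτ'⟩ := σ.exists_isBSP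
  rw [← h]
  exact (Model.opt_le (M := .BSP) ⟨_, τ, hτ, rfl⟩).trans hτ'

theorem opt_le_two_mul_opt (hP : 0 < P) (A B : Model) : A.opt G P g ≤ 2 * B.opt G P g := by
  have h1 := opt_SPD_le_opt_alphaBeta G g hP
  have h2 := opt_SPD_le_opt_maxBSP G g hP
  have h3 := opt_alphaBeta_le_opt_BSP G g hP
  have h4 := opt_maxBSP_le_opt_BSP G g hP
  have h5 := opt_BSP_le_two_mul_opt_SPD G g hP
  cases A <;> cases B <;> omega

end Opt

/-! ### Overlapping computation and communication: a star -/

/-- `2 n` nodes with a common successor. -/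
def starDAG (n : ℕ) : DAG (Option (Fin 2 × Fin n)) where
  Adj u v := u ≠ none ∧ v = none
  acyclic v h := by
    have : ∀ u w, Relation.TransGen (fun u v : Option (Fin 2 × Fin n) => u ≠ none ∧ v = none) u w →
        u ≠ none ∧ w = none := by
      intro u w h
      induction h with
      | single h => exact h
      | tail _ h ih => exact ⟨ih.1, h.2⟩
    exact (this v v h).1 (this v v h).2

/-- Pipelining: each processor computes its node `i` in superstep `i`, processor 1 sends that value
in superstep `i + 1`, and the sink is computed in superstep `n + 1` on processor 0. Every superstep
costs at most 1. -/
theorem opt_maxBSP_starDAG_le (n : ℕ) : Model.maxBSP.opt (starDAG n) 2 1 ≤ n + 2 := by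
  classical
  let emb : Fin n → Option (Fin 2 × Fin n) × Fin 2 × Fin 2 × Fin (n + 2) :=
    fun i => (some (1, i), 1, 0, i.succ.castSucc)
  let σ : SuperstepSchedule (starDAG n) 2 (n + 2) :=
    { proc := fun v => v.elim 0 Prod.fst
      step := fun v => v.elim (Fin.last _) fun x => x.2.castSucc.castSucc
      comm := Finset.univ.image emb
      comm_source := by
        intro v p₁ p₂ s h
        obtain ⟨i, -, h⟩ := Finset.mem_image.1 h
        simp only [emb, Prod.mk.injEq] at h
        obtain ⟨rfl, rfl, -⟩ := h
        rfl
      prec_same := by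
        rintro u v ⟨-, rfl⟩ -
        exact Fin.le_last _
      prec_diff := by
        rintro (_ | ⟨p, i⟩) v ⟨hu, rfl⟩ hp
        · exact absurd rfl hu
        · have hp1 : p = 1 := by
            simp only [Option.elim] at hp
            omega
          subst hp1
          exact ⟨_, Finset.mem_image.2 ⟨i, Finset.mem_univ _, rfl⟩, Fin.castSucc_lt_last _⟩ }
  have hcomm : ∀ c ∈ σ.comm, ∀ c' ∈ σ.comm, c.2.2.2 = c'.2.2.2 → c = c' := by
    intro c hc c' hc' h
    obtain ⟨i, -, rfl⟩ := Finset.mem_image.1 hc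
    obtain ⟨j, -, rfl⟩ := Finset.mem_image.1 hc'
    simp only [emb, Fin.castSucc_inj, Fin.succ_inj] at h
    rw [h]
  have hσ : σ.IsMaxBSP := by
    intro v p₁ p₂ s h
    obtain ⟨i, -, h⟩ := Finset.mem_image.1 h
    simp only [emb, Prod.mk.injEq] at h
    obtain ⟨rfl, -, -, rfl⟩ := h
    simp [σ, Fin.lt_def]
  have hcost : σ.maxBSPCost 1 ≤ ∑ _s : Fin (n + 2), 1 := by
    refine Finset.sum_le_sum fun s _ => max_le (Finset.sup_le fun p _ => ?_) ?_
    · refine Finset.card_le_one.2 fun u hu v hv => ?_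
      obtain ⟨-, hu1, hu2⟩ := Finset.mem_filter.1 hu
      obtain ⟨-, hv1, hv2⟩ := Finset.mem_filter.1 hv
      rw [← hv1] at hu1
      rw [← hv2] at hu2
      rcases u with _ | ⟨p, i⟩ <;> rcases v with _ | ⟨q, j⟩ <;>
        simp only [σ, Option.elim, Fin.ext_iff, Fin.val_last, Fin.val_castSucc] at hu1 hu2
      · rfl
      · omega
      · omega
      · rw [Fin.ext hu1, Fin.ext hu2]
    · rw [Nat.one_mul]
      refine Finset.sup_le fun p _ => max_le (Finset.card_le_one.2 fun c hc c' hc' => ?_)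
        (Finset.card_le_one.2 fun c hc c' hc' => ?_) <;>
      · obtain ⟨hc, -, h⟩ := Finset.mem_filter.1 hc
        obtain ⟨hc', -, h'⟩ := Finset.mem_filter.1 hc'
        exact hcomm c hc c' hc' (h.trans h'.symm)
  refine (Model.opt_le (M := .maxBSP) ⟨_, σ, hσ, rfl⟩).trans (hcost.trans ?_)
  simp

/-- The processor of the sink either computes or receives the value of each of the other nodes, and
cannot do both in the same time step. -/
theorem le_opt_alphaBeta_starDAG (n : ℕ) : 2 * n ≤ Model.alphaBeta.opt (starDAG n) 2 1 := by
  classical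
  obtain ⟨σ, hσ, h⟩ := Model.alphaBeta.attains_opt (starDAG n) 1 Nat.two_pos
  rw [← h]
  have hadj : ∀ x, (starDAG n).Adj (some x) none := fun x => ⟨Option.some_ne_none x, rfl⟩
  -- Each leaf is charged to one time step of the sink's processor: the one computing it, or the
  -- single step `t₀ + 1` of the interval in which it is received.
  have hslot : ∀ x, ∃ t, 0 < t ∧ t ≤ σ.makespan ∧
      (σ.proc (some x) = σ.proc none ∧ t = σ.time (some x) ∨
        ∃ t₀, t = t₀ + 1 ∧ (some x, σ.proc (some x), σ.proc none, t₀) ∈ σ.comm) := by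
    intro x
    by_cases hp : σ.proc (some x) = σ.proc none
    · exact ⟨_, σ.time_pos _, σ.time_le_makespan _, Or.inl ⟨hp, rfl⟩⟩
    · obtain ⟨t₀, ht, hlt⟩ := σ.prec_diff _ _ (hadj x) hp
      exact ⟨t₀ + 1, Nat.succ_pos _, hlt.le.trans (σ.time_le_makespan _), Or.inr ⟨t₀, rfl, ht⟩⟩
  choose slot hpos hle hkind using hslot
  have hinj : Function.Injective slot := by
    intro x y hxy
    have hx := hkind x
    have hy := hkind y
    rw [hxy] at hx
    rcases hx with ⟨hpx, htx⟩ | ⟨t, htx, hcx⟩ <;> rcases hy with ⟨hpy, hty⟩ | ⟨t', hty, hcy⟩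
    · exact Option.some_injective _ (σ.compute_one _ _ (hpx.trans hpy.symm) (htx.symm.trans hty))
    · exact absurd ⟨by omega, by omega⟩ (hσ _ _ _ _ hcy (some x) (Or.inr hpx))
    · exact absurd ⟨by omega, by omega⟩ (hσ _ _ _ _ hcx (some y) (Or.inr hpy))
    · by_contra hne
      obtain rfl : t = t' := by omega
      refine (σ.comm_port _ _ _ _ _ _ _ _ hcx hcy (fun h => hne ?_) ?_).2 rfl
      · exact Option.some_injective _ (Prod.mk.inj h).1
      · rw [disjoint_self]
        exact (Set.nonempty_Ioc.2 (Nat.lt_succ_self t)).ne_empty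
  have := Finset.card_le_card_of_injOn (s := Finset.univ) (t := Finset.Icc 1 σ.makespan) slot
    (fun x _ => by
      have := hpos x
      have := hle x
      simp only [Finset.coe_Icc, Set.mem_Icc]
      omega) hinj.injOn
  simpa using this

/-- The factor `c` will be `2 - ε` or `3 / 2 - ε`, which is negative for large `ε`; then the claim
is trivial. -/
theorem mul_le_of_le_of_le {c x x' y y' : ℝ} (h : c * x' ≤ y') (hx : x ≤ x') (hy : y' ≤ y)
    (hx0 : 0 ≤ x) (hy0 : 0 ≤ y) : c * x ≤ y := by
  rcases le_total 0 c with hc | hc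
  · exact (mul_le_mul_of_nonneg_left hx hc).trans (h.trans hy)
  · exact (mul_nonpos_of_nonpos_of_nonneg hc hx0).trans hy0

theorem exists_two_sub_mul_opt_maxBSP_le (ε : ℝ) (hε : 0 < ε) :
    ∃ n : ℕ, (2 - ε) * (Model.maxBSP.opt (starDAG n) 2 1 : ℝ) ≤
      Model.alphaBeta.opt (starDAG n) 2 1 := by
  -- The target `(2 - ε) * (n + 2) ≤ 2 * n` amounts to `4 ≤ ε * (n + 2)`.
  obtain ⟨n, hn⟩ := exists_nat_gt (4 / ε)
  rw [div_lt_iff₀ hε] at hn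
  refine ⟨n, mul_le_of_le_of_le (x' := ((n + 2 : ℕ) : ℝ)) (y' := ((2 * n : ℕ) : ℝ)) ?_
    (Nat.cast_le.2 (opt_maxBSP_starDAG_le n)) (Nat.cast_le.2 (le_opt_alphaBeta_starDAG n))
    (Nat.cast_nonneg _) (Nat.cast_nonneg _)⟩
  push_cast
  linarith

/-! ### The cost of barriers: staggered communication -/

/-- The node `(k, j, i)` is at position `i` of the part `j` of the gadget `k`; the three parts of a
gadget form a ring. The nodes at positions below `k` precede the node at position `k`, which
precedes the nodes at higher positions of the parts `j` and `j - 1`. The nodes at positions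
between `k` and `g + 1` precede the one at position `g + 1`. -/
def staggeredDAG (g : ℕ) : DAG (Fin (g + 1) × Fin 3 × Fin (g + 2)) where
  Adj u v := u.1 = v.1 ∧
    ((u.2.2 : ℕ) < u.1 ∧ (v.2.2 : ℕ) = u.1 ∧ u.2.1 = v.2.1 ∨
      (u.2.2 : ℕ) = u.1 ∧ (u.1 : ℕ) < v.2.2 ∧ (u.2.1 = v.2.1 ∨ u.2.1 = v.2.1 + 1) ∨
      (u.1 : ℕ) < u.2.2 ∧ (u.2.2 : ℕ) < g + 1 ∧ (v.2.2 : ℕ) = g + 1 ∧ u.2.1 = v.2.1)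
  acyclic v h := by
    have := h.lift (p := (· < ·)) (fun u => (u.2.2 : ℕ)) fun u w h => by
      show (u.2.2 : ℕ) < w.2.2
      omega
    rw [Relation.transGen_eq_self] at this
    exact lt_irrefl _ this

/-- Each part gets its own processor. In gadget `k` the positions up to `k` fill the steps up to `k
+ 1`; then the three processors pause for `g` steps while the values at position `k` move around the
ring, and compute the rest afterwards. Different gadgets pause at different times at no extra cost.
-/
theorem opt_alphaBeta_staggeredDAG_le (g : ℕ) :
    Model.alphaBeta.opt (staggeredDAG g) ((g + 1) * 3) g ≤ 2 * g + 2 := by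
  let pr : Fin (g + 1) × Fin 3 ≃ Fin ((g + 1) * 3) := finProdFinEquiv
  let time : Fin (g + 1) × Fin 3 × Fin (g + 2) → ℕ := fun v =>
    if (v.2.2 : ℕ) ≤ v.1 then v.2.2 + 1 else v.2.2 + 1 + g
  let σ : SPDSchedule (staggeredDAG g) ((g + 1) * 3) g :=
    { proc := fun v => pr (v.1, v.2.1)
      time := time
      comm := {x | ∃ (k : Fin (g + 1)) (j : Fin 3),
        x = ((k, j + 1, k.castSucc), pr (k, j + 1), pr (k, j), (k : ℕ) + 1)}
      time_pos := by
        intro v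
        simp only [time]
        split_ifs <;> omega
      comm_available := by
        rintro v p₁ p₂ t ⟨k, j, h⟩
        simp only [Prod.mk.injEq] at h
        obtain ⟨rfl, -, -, rfl⟩ := h
        simp [time]
      comm_port := by
        rintro v p₁ p₂ t w q₁ q₂ t' ⟨k, j, h⟩ ⟨k', j', h'⟩ hne -
        rw [h, h'] at hne
        simp only [Prod.mk.injEq] at h h'
        obtain ⟨-, rfl, rfl, -⟩ := h
        obtain ⟨-, rfl, rfl, -⟩ := h'
        constructor <;>
        · intro h
          have := pr.injective h
          simp only [Prod.mk.injEq, add_left_inj] at this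
          obtain ⟨rfl, rfl⟩ := this
          exact hne rfl
      compute_one := by
        rintro ⟨k, j, i⟩ ⟨k', j', i'⟩ hp ht
        have := pr.injective hp
        simp only [Prod.mk.injEq] at this
        obtain ⟨rfl, rfl⟩ := this
        obtain rfl : i = i' := by
          simp only [time] at ht
          rw [Fin.ext_iff]
          split_ifs at ht <;> omega
        rfl
      prec_same := by
        rintro ⟨k, j, i⟩ ⟨k', j', i'⟩ ⟨hk, h⟩ -
        simp only at hk h
        subst hk
        simp only [time]
        split_ifs <;> omega
      prec_diff := by
        rintro ⟨k, j, i⟩ ⟨k', j', i'⟩ ⟨hk, h⟩ hp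
        simp only at hk h
        subst hk
        have hj : j ≠ j' := by
          rintro rfl
          exact hp rfl
        obtain ⟨hi, hi', rfl⟩ : (i : ℕ) = k ∧ (k : ℕ) < i' ∧ j = j' + 1 := by tauto
        obtain rfl : i = k.castSucc := Fin.ext hi
        refine ⟨k + 1, ⟨k, j', rfl⟩, ?_⟩
        simp only [time]
        split_ifs <;> omega }
  have hσ : σ.IsAlphaBeta := by
    rintro u p₁ p₂ t ⟨k, j, h⟩ ⟨k', j', i'⟩ hp ⟨h1, h2⟩
    simp only [Prod.mk.injEq] at h
    obtain ⟨-, rfl, rfl, rfl⟩ := h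
    have hk : k' = k := by
      rcases hp with hp | hp
      · exact (Prod.mk.inj (pr.injective hp)).1
      · exact (Prod.mk.inj (pr.injective hp)).1
    subst hk
    simp only [σ, time] at h1 h2
    split_ifs at h1 h2 <;> omega
  refine (Model.opt_le (M := .alphaBeta) ⟨σ, hσ, rfl⟩).trans (Finset.sup_le fun v _ => ?_)
  simp only [σ, time]
  split_ifs <;> omega

namespace SuperstepSchedule

variable {V : Type*} {G : DAG V} {P S : ℕ} (σ : SuperstepSchedule G P S)

/-- Each node is computed by the processor `q` or, if its value is needed there, sent to `q`. -/
theorem card_le_sum_workCost_add_sum_commCost [Fintype V] (q : Fin P) (T : Finset (Fin S))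
    (N : Finset V) (hT : ∀ u ∈ N, σ.proc u = q → σ.step u ∈ T)
    (hq : ∀ u ∈ N, σ.proc u ≠ q → ∃ v, G.Adj u v ∧ σ.proc v = q) :
    N.card ≤ ∑ s ∈ T, σ.workCost s + ∑ s, σ.commCost s := by
  classical
  rw [← Finset.card_filter_add_card_filter_not (s := N) fun u => σ.proc u = q]
  refine add_le_add ?_ ?_
  · rw [Finset.card_eq_sum_card_fiberwise (f := σ.step) (t := T) (fun u hu => by
      obtain ⟨h1, h2⟩ := Finset.mem_filter.1 hu
      exact hT u h1 h2)]
    refine Finset.sum_le_sum fun s _ => le_trans (Finset.card_le_card fun u hu => ?_)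
      (σ.card_le_workCost s q)
    simp only [Finset.mem_filter] at hu
    simpa using ⟨hu.1.2, hu.2⟩
  · have hs : ∀ u ∈ N.filter fun u => ¬ σ.proc u = q, ∃ c ∈ σ.comm, c.1 = u ∧ c.2.2.1 = q := by
      intro u hu
      obtain ⟨h1, h2⟩ := Finset.mem_filter.1 hu
      obtain ⟨v, huv, hv⟩ := hq u h1 h2
      obtain ⟨s, hs, -⟩ := σ.prec_diff u v huv (by rw [hv]; exact h2)
      exact ⟨_, hs, rfl, hv⟩
    calc (N.filter fun u => ¬ σ.proc u = q).card
        ≤ ((σ.comm.filter fun c => c.2.2.1 = q).image Prod.fst).card := by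
          refine Finset.card_le_card fun u hu => ?_
          obtain ⟨c, hc, h1, h2⟩ := hs u hu
          exact Finset.mem_image.2 ⟨c, Finset.mem_filter.2 ⟨hc, h2⟩, h1⟩
      _ ≤ (σ.comm.filter fun c => c.2.2.1 = q).card := Finset.card_image_le
      _ = ∑ s, σ.received s q := by
          rw [Finset.card_eq_sum_card_fiberwise (f := fun c => c.2.2.2) (t := Finset.univ)
            (fun c _ => Finset.mem_coe.2 (Finset.mem_univ _))]
          simp only [Finset.filter_filter, received]
      _ ≤ ∑ s, σ.commCost s := Finset.sum_le_sum fun s _ => σ.received_le_commCost s q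

end SuperstepSchedule

/-- Some value of the gadget `k` is sent after at least `k - 2` and before at least `g - k - 2`
units of work. -/
theorem exists_superstep_staggeredDAG {g P S : ℕ} (σ : SuperstepSchedule (staggeredDAG g) P S)
    (hσ : σ.IsMaxBSP) (hcomm : ∑ s, σ.commCost s ≤ 2)
    (hwork : ∑ s, σ.workCost s < 3 * g) (k : ℕ) (hk : k ≤ g) :
    ∃ s, 1 ≤ σ.commCost s ∧ k ≤ ∑ s' ∈ Finset.Iio s, σ.workCost s' + 2 ∧
      g ≤ k + ∑ s' ∈ Finset.Ioi s, σ.workCost s' + 2 := by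
  classical
  let k' : Fin (g + 1) := ⟨k, by omega⟩
  let a : Fin 3 → Fin (g + 1) × Fin 3 × Fin (g + 2) := fun j => (k', j, ⟨k, by omega⟩)
  let z : Fin 3 → Fin (g + 1) × Fin 3 × Fin (g + 2) := fun j => (k', j, Fin.last _)
  -- Otherwise the ring forces all `a j` and `z j` onto one processor, which must compute or receive
  -- all `3 * (g + 2)` nodes of the gadget; less than `3 * g` work and at most 2 receptions do not
  -- suffice.
  obtain ⟨j, j', hjj, hne⟩ : ∃ j j', (j' = j ∨ j' = j + 1) ∧ σ.proc (a j') ≠ σ.proc (z j) := by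
    by_contra! h
    have h1 : ∀ j, σ.proc (a j) = σ.proc (z j) := fun j => h j j (Or.inl rfl)
    have h2 : ∀ j, σ.proc (a (j + 1)) = σ.proc (z j) := fun j => h j _ (Or.inr rfl)
    have h3 : ∀ j, σ.proc (a j) = σ.proc (a 0) := by
      have h01 := (h2 0).trans (h1 0).symm
      have h12 := (h2 1).trans (h1 1).symm
      intro j
      fin_cases j
      · rfl
      · exact h01
      · exact h12.trans h01
    have h4 : ∀ j, σ.proc (z j) = σ.proc (a 0) := fun j => (h1 j).symm.trans (h3 j)
    have := σ.card_le_sum_workCost_add_sum_commCost (σ.proc (a 0)) Finset.univ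
      ((Finset.univ : Finset (Fin 3 × Fin (g + 2))).image fun x => (k', x))
      (fun _ _ _ => Finset.mem_univ _) (by
        intro u hu hp
        obtain ⟨⟨j, i⟩, -, rfl⟩ := Finset.mem_image.1 hu
        rcases lt_trichotomy (i : ℕ) k with h | h | h
        · exact ⟨a j, ⟨rfl, Or.inl ⟨h, rfl, rfl⟩⟩, h3 j⟩
        · have hi : i = ⟨k, by omega⟩ := Fin.ext h
          rw [hi] at hp
          exact absurd (h3 j) hp
        · rcases Nat.lt_or_ge i (g + 1) with h' | h'
          · exact ⟨z j, ⟨rfl, Or.inr (Or.inr ⟨h, h', rfl, rfl⟩)⟩, h4 j⟩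
          · obtain rfl : i = Fin.last _ := Fin.ext (by simp; omega)
            exact absurd (h4 j) hp)
    rw [Finset.card_image_of_injective _ (Prod.mk_right_injective k')] at this
    simp at this
    omega
  have hadj : (staggeredDAG g).Adj (a j') (z j) :=
    ⟨rfl, Or.inr (Or.inl ⟨rfl, by simp [a, z, k']; omega, hjj⟩)⟩
  obtain ⟨s₀, hs₀, -⟩ := σ.prec_diff _ _ hadj hne
  -- The earliest transmission is taken, so that whatever needs this value on the receiving
  -- processor comes after `s`.
  obtain ⟨s, hs, hmin⟩ := WellFounded.has_min (wellFounded_lt (α := Fin S))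
    {s | (a j', σ.proc (a j'), σ.proc (z j), s) ∈ σ.comm} ⟨s₀, hs₀⟩
  have hstep := hσ _ _ _ _ hs
  refine ⟨s, ?_, ?_, ?_⟩
  · refine le_trans ?_ (σ.sent_le_commCost s (σ.proc (a j')))
    exact Finset.card_pos.2 ⟨_, Finset.mem_filter.2 ⟨hs, rfl, rfl⟩⟩
  -- The `k` predecessors of `a j'` are computed on its processor before `s`, except for at most 2
  -- that are received.
  · have := σ.card_le_sum_workCost_add_sum_commCost (σ.proc (a j')) (Finset.Iio s)
      (Finset.univ.image fun i : Fin k => (k', j', i.castLE (by omega)))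
      (by
        intro u hu hp
        obtain ⟨i, -, rfl⟩ := Finset.mem_image.1 hu
        exact Finset.mem_Iio.2 ((σ.prec_same (k', j', i.castLE (by omega)) (a j')
          ⟨rfl, Or.inl ⟨i.isLt, rfl, rfl⟩⟩ hp).trans_lt hstep))
      (by
        intro u hu hp
        obtain ⟨i, -, rfl⟩ := Finset.mem_image.1 hu
        exact ⟨a j', ⟨rfl, Or.inl ⟨i.isLt, rfl, rfl⟩⟩, rfl⟩)
    rw [Finset.card_image_of_injective _ (fun i i' h => by simpa using h), Finset.card_fin] at this
    omega
  -- The `g - k` nodes strictly between `a` and `z` in part `j` all depend on `a j'`. Those computed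
  -- on the processor of `z j` therefore come after `s`; at most 2 are received instead.
  · have := σ.card_le_sum_workCost_add_sum_commCost (σ.proc (z j)) (Finset.Ioi s)
      (Finset.univ.image fun i : Fin (g - k) => (k', j, ⟨k + 1 + i, by omega⟩))
      (by
        intro u hu hp
        obtain ⟨i, -, rfl⟩ := Finset.mem_image.1 hu
        obtain ⟨s', hs', hlt⟩ := σ.prec_diff (a j') (k', j, ⟨k + 1 + i, by omega⟩)
          ⟨rfl, Or.inr (Or.inl ⟨rfl, by simp [a, k']; omega, hjj⟩)⟩ (by rw [hp]; exact hne)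
        rw [hp] at hs'
        exact Finset.mem_Ioi.2 ((not_lt.1 (hmin s' hs')).trans_lt hlt))
      (by
        intro u hu hp
        obtain ⟨i, -, rfl⟩ := Finset.mem_image.1 hu
        exact ⟨z j, ⟨rfl, Or.inr (Or.inr ⟨by simp [k']; omega, by simp; omega, rfl, rfl⟩)⟩, rfl⟩)
    rw [Finset.card_image_of_injective _ (fun i i' h => by
      simp only [Prod.mk.injEq, Fin.mk.injEq, true_and] at h
      exact Fin.ext (by omega)), Finset.card_fin] at this
    omega

/-- Let `y` be the cost before the first superstep `s₁` of cost at least `g`. If `y` is nearly `g`,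
the superstep given by `k = 0` has about `g` before it, costs `g`, and has about `g` after it.
Otherwise `k = y + 3` is too large to be served by `s₁`, so a later superstep of cost `g` exists;
the total is at least `y + g + g` plus the `g - k - 2` after it. -/
theorem three_mul_le_sum_add_five {g S : ℕ} (c : Fin S → ℕ)
    (h : ∀ k ≤ g, ∃ s, g ≤ c s ∧ k ≤ ∑ s' ∈ Finset.Iio s, c s' + 2 ∧
      g ≤ k + ∑ s' ∈ Finset.Ioi s, c s' + 2) :
    3 * g ≤ ∑ s, c s + 5 := by
  obtain ⟨s₀, hs₀, -, hafter⟩ := h 0 (Nat.zero_le g)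
  obtain ⟨s₁, hs₁, hmin⟩ := WellFounded.has_min (wellFounded_lt (α := Fin S)) {s | g ≤ c s} ⟨s₀, hs₀⟩
  have hsplit : ∀ s, ∑ s' ∈ Finset.Iio s, c s' + c s + ∑ s' ∈ Finset.Ioi s, c s' = ∑ s, c s := by
    intro s
    have h1 : Disjoint (Finset.Iio s) (Finset.Ici s) := by
      rw [Finset.disjoint_left]
      intro i hi hi'
      exact absurd (Finset.mem_Iio.1 hi) (not_lt.2 (Finset.mem_Ici.1 hi'))
    have h2 : (Finset.univ : Finset (Fin S)) = Finset.Iio s ∪ Finset.Ici s := by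
      ext i
      simpa using lt_or_ge i s
    rw [h2, Finset.sum_union h1, ← Finset.Ioi_insert, Finset.sum_insert (by simp), add_assoc]
  have hmono : ∀ s, s₁ < s → ∑ i ∈ Finset.Iio s₁, c i + c s₁ ≤ ∑ i ∈ Finset.Iio s, c i := fun s =>
    sum_Iio_add_le_sum_Iio c
  have hge : ∀ s, g ≤ c s → s = s₁ ∨ s₁ < s := fun s hs =>
    (not_lt.1 (hmin s hs)).eq_or_lt.imp Eq.symm id
  by_cases hy : ∑ i ∈ Finset.Iio s₁, c i + 3 ≤ g
  · obtain ⟨s, hs, hb, ha⟩ := h _ hy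
    have h1 := hsplit s
    rcases hge s hs with rfl | h'
    · omega
    · have := hmono s h'
      have : g ≤ c s₁ := hs₁
      omega
  · have h1 := hsplit s₀
    rcases hge s₀ hs₀ with rfl | h'
    · omega
    · have := hmono s₀ h'
      omega

/-- Total communication of at least 3 values or total work of at least `3 * g` already costs `3 *
g`. In the remaining case every gadget yields a superstep of cost at least `g` as required by
`three_mul_le_sum_add_five`. -/
theorem le_opt_maxBSP_staggeredDAG {g P : ℕ} (hP : 0 < P) :
    3 * g ≤ Model.maxBSP.opt (staggeredDAG g) P g + 5 := by
  obtain ⟨S, σ, hσ, h⟩ := Model.maxBSP.attains_opt (staggeredDAG g) g hP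
  rw [← h]
  have hw : ∑ s, σ.workCost s ≤ σ.maxBSPCost g := Finset.sum_le_sum fun s _ => le_max_left _ _
  have hc : g * ∑ s, σ.commCost s ≤ σ.maxBSPCost g := by
    rw [Finset.mul_sum]
    exact Finset.sum_le_sum fun s _ => le_max_right _ _
  rcases Nat.lt_or_ge 2 (∑ s, σ.commCost s) with hcomm | hcomm
  · have := Nat.mul_le_mul_left g (Nat.succ_le_of_lt hcomm)
    omega
  rcases Nat.lt_or_ge (∑ s, σ.workCost s) (3 * g) with hwork | hwork
  · refine three_mul_le_sum_add_five (fun s => max (σ.workCost s) (g * σ.commCost s))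
      fun k hk => ?_
    obtain ⟨s, h1, h2, h3⟩ := exists_superstep_staggeredDAG σ hσ hcomm hwork k hk
    refine ⟨s, le_max_of_le_right (Nat.le_mul_of_pos_right g h1), h2.trans ?_, h3.trans ?_⟩
    · gcongr
      exact le_max_left _ _
    · gcongr
      exact le_max_left _ _
  · omega

theorem exists_three_halves_sub_mul_opt_alphaBeta_le (ε : ℝ) (hε : 0 < ε) :
    ∃ g : ℕ, 0 < g ∧
      (3 / 2 - ε) * (Model.alphaBeta.opt (staggeredDAG g) ((g + 1) * 3) g : ℝ) ≤
        Model.maxBSP.opt (staggeredDAG g) ((g + 1) * 3) g := by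
  -- With `g = n + 1` the target `(3 / 2 - ε) * (2 * g + 2) ≤ 3 * g - 5` amounts to `8 ≤ ε * (2 * n
  -- + 4)`.
  obtain ⟨n, hn⟩ := exists_nat_gt (4 / ε)
  rw [div_lt_iff₀ hε] at hn
  refine ⟨n + 1, Nat.succ_pos n, mul_le_of_le_of_le (x' := ((2 * (n + 1) + 2 : ℕ) : ℝ))
    (y' := 3 * (n + 1) - 5) ?_ (Nat.cast_le.2 (opt_alphaBeta_staggeredDAG_le (n + 1))) ?_
    (Nat.cast_nonneg _) (Nat.cast_nonneg _)⟩
  · push_cast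
    nlinarith
  · have := le_opt_maxBSP_staggeredDAG (g := n + 1) (P := (n + 1 + 1) * 3) (by omega)
    have h' : ((3 * (n + 1) : ℕ) : ℝ) ≤ _ := Nat.cast_le.2 this
    push_cast at h'
    linarith

end DagSched

theorem mainTheorem7 :
    -- any two of the four optimum costs differ by a factor of at most 2
    (∀ (V : Type*) [Fintype V] (G : DagSched.DAG V) (P g : ℕ), 0 < P →
      ∀ A B : DagSched.Model, A.opt G P g ≤ 2 * B.opt G P g) ∧
    -- lower bound `2 - ε` for four pairs of models
    (∀ ε : ℝ, 0 < ε →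
      ∃ (P g : ℕ) (V : Type) (_ : Fintype V) (_ : Nonempty V) (G : DagSched.DAG V),
        0 < P ∧ 0 < g ∧
        (2 - ε) * (DagSched.Model.SPD.opt G P g : ℝ) ≤ DagSched.Model.alphaBeta.opt G P g ∧
        (2 - ε) * (DagSched.Model.SPD.opt G P g : ℝ) ≤ DagSched.Model.BSP.opt G P g ∧
        (2 - ε) * (DagSched.Model.maxBSP.opt G P g : ℝ) ≤ DagSched.Model.alphaBeta.opt G P g ∧
        (2 - ε) * (DagSched.Model.maxBSP.opt G P g : ℝ) ≤ DagSched.Model.BSP.opt G P g) ∧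
    -- lower bound `3 / 2 - ε` for three pairs of models
    (∀ ε : ℝ, 0 < ε →
      ∃ (P g : ℕ) (V : Type) (_ : Fintype V) (_ : Nonempty V) (G : DagSched.DAG V),
        0 < P ∧ 0 < g ∧
        (3 / 2 - ε) * (DagSched.Model.SPD.opt G P g : ℝ) ≤ DagSched.Model.maxBSP.opt G P g ∧
        (3 / 2 - ε) * (DagSched.Model.alphaBeta.opt G P g : ℝ) ≤ DagSched.Model.BSP.opt G P g ∧
        (3 / 2 - ε) * (DagSched.Model.alphaBeta.opt G P g : ℝ) ≤
          DagSched.Model.maxBSP.opt G P g) := by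
  refine ⟨fun V _ G P g hP A B => DagSched.opt_le_two_mul_opt G g hP A B, fun ε hε => ?_,
    fun ε hε => ?_⟩
  · obtain ⟨n, hn⟩ := DagSched.exists_two_sub_mul_opt_maxBSP_le ε hε
    have h1 := DagSched.opt_SPD_le_opt_maxBSP (DagSched.starDAG n) (P := 2) 1 Nat.two_pos
    have h2 := DagSched.opt_alphaBeta_le_opt_BSP (DagSched.starDAG n) (P := 2) 1 Nat.two_pos
    refine ⟨2, 1, _, inferInstance, inferInstance, DagSched.starDAG n, Nat.two_pos, Nat.one_pos,
      ?_, ?_, ?_, ?_⟩ <;>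
    refine DagSched.mul_le_of_le_of_le hn ?_ ?_ (Nat.cast_nonneg _) (Nat.cast_nonneg _) <;>
    first | exact le_rfl | exact Nat.cast_le.2 h1 | exact Nat.cast_le.2 h2
  · obtain ⟨g, hg, h⟩ := DagSched.exists_three_halves_sub_mul_opt_alphaBeta_le ε hε
    have hP : 0 < (g + 1) * 3 := by omega
    have h1 := DagSched.opt_SPD_le_opt_alphaBeta (DagSched.staggeredDAG g) g hP
    have h2 := DagSched.opt_maxBSP_le_opt_BSP (DagSched.staggeredDAG g) g hP
    refine ⟨(g + 1) * 3, g, _, inferInstance, inferInstance, DagSched.staggeredDAG g, hP, hg,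
      ?_, ?_, ?_⟩ <;>
    refine DagSched.mul_le_of_le_of_le h ?_ ?_ (Nat.cast_nonneg _) (Nat.cast_nonneg _) <;>
    first | exact le_rfl | exact Nat.cast_le.2 h1 | exact Nat.cast_le.2 h2
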